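/- For a finitely generated group $G$ and $p$ equal to $0$ or a prime, let $m_p(G)$ denote the minimum dimension $d$ such that there is an injective homomorphism $G\hookrightarrow GL(d,\mathbb F)$ for some field $\mathbb F$ of characteristic $p$ (with $m_p(G)=\infty$ if there is no such homomorphism for any $d$). Let $F_2$ be the free group on $x,y$, let $\alpha$ be the automorphism of $F_2$ with $\alpha(x)=x$ and $\alpha(y)=yx$, and let $G=F_2\rtimes_\alpha\mathbb Z$ be the semidirect product in which the generator $1\in\mathbb Z$ acts on $F_2$ as $\alpha$. Then, for every $p$ equal to $0$ or a prime, $$3\le m_p(G)\le 6 .$$ -/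

import Mathlib

universe u v

/-- `G` has a faithful linear representation of dimension `d` over some field of
characteristic `p`: an injective homomorphism into `GL(d, F)`. -/
def HasFaithfulRepOfDim (p : ℕ) (G : Type v) [Group G] (d : ℕ) : Prop :=
  ∃ (F : Type u) (_ : Field F) (_ : CharP F p) (ρ : G →* Matrix.GeneralLinearGroup (Fin d) F),
    Function.Injective ρ

/-- `m_p(G)`: the minimum dimension of a faithful linear representation of `G` over all fields
(in the universe `u`) of characteristic `p`, and `⊤` if there is no such representation. -/
noncomputable def minFaithfulDim (p : ℕ) (G : Type v) [Group G] : ℕ∞ :=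
  sInf {m : ℕ∞ | ∃ d : ℕ, m = (d : ℕ∞) ∧ HasFaithfulRepOfDim.{u, v} p G d}

namespace FreeByCyclic

/-- The free group of rank two. -/
abbrev F₂ : Type := FreeGroup (Fin 2)

/-- The first free generator. -/
def x : F₂ := FreeGroup.of 0

/-- The second free generator. -/
def y : F₂ := FreeGroup.of 1

/-- The automorphism `α` of `F₂` with `α x = x` and `α y = y x`; its inverse sends `x` to `x`
and `y` to `y x⁻¹`. -/
def α : MulAut F₂ :=
  MonoidHom.toMulEquiv (FreeGroup.lift ![x, y * x]) (FreeGroup.lift ![x, y * x⁻¹])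
    (by ext i; fin_cases i <;> simp [x, y])
    (by ext i; fin_cases i <;> simp [x, y])

theorem α_x : α x = x := by simp [α, x]

theorem α_y : α y = y * x := by simp [α, x, y]

/-- The semidirect product `F₂ ⋊_α ℤ`, where `n : ℤ` acts on `F₂` as `α ^ n`. -/
abbrev G : Type := F₂ ⋊[zpowersHom (MulAut F₂) α] Multiplicative ℤ

end FreeByCyclic

/-!
Lower bound: if an endomorphism of a space of dimension at most two is not scalar, then every
endomorphism commuting with it is a polynomial in it, so any two of these commute. In `G` the
stable letter commutes with `x` and with `y x y⁻¹` but not with `y`, while `x` and `y x y⁻¹` do not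
commute.

Upper bound: no nontrivial power of `α` is inner, so a representation of `G` is faithful as soon as
it is faithful on `F₂`. Over a field with a valuation, send `x` to `diag (l⁻¹, l, 1)`, the stable
letter to `diag (1, l⁻¹, 1)`, and `y` to a permutation matrix plus a large multiple of a rank-one
matrix. If no nontrivial power of `l` is congruent to `1` modulo the maximal ideal, `x` and `y` play
ping-pong on directions modulo the maximal ideal: nontrivial powers of `y` contract to two
attracting directions, which the nontrivial powers of `x` move off the two repelling planes. Thus
`m_p(G) = 3`.
-/

open Polynomial

section CyclicVector

theorem exists_aeval_eq_of_commute {R M : Type*} [CommSemiring R] [AddCommMonoid M] [Module R M]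
    {A B : Module.End R M} {w : M} (hw : Function.Surjective fun q : R[X] ↦ aeval B q w)
    (hAB : Commute A B) : ∃ q : R[X], aeval B q = A := by
  obtain ⟨q, hq⟩ := hw (A w)
  refine ⟨q, LinearMap.ext fun m ↦ ?_⟩
  obtain ⟨r, rfl⟩ := hw m
  have hAr : Commute A (aeval B r) := by
    rw [aeval_eq_sum_range]
    exact Commute.sum_right _ _ _ fun i _ ↦ (hAB.pow_right i).smul_right _
  calc aeval B q (aeval B r w) = aeval B r (aeval B q w) := by
        rw [← Module.End.mul_apply, ← Module.End.mul_apply, ← map_mul, ← map_mul, mul_comm]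
    _ = aeval B r (A w) := congrArg _ hq
    _ = A (aeval B r w) := by
        rw [← Module.End.mul_apply, ← Module.End.mul_apply, hAr.eq]

theorem exists_cyclic_vector_of_finrank_le_two {K V : Type*} [Field K] [AddCommGroup V]
    [Module K V] [FiniteDimensional K V] (hV : Module.finrank K V ≤ 2) {B D : Module.End K V}
    (hDB : ¬ Commute D B) : ∃ w : V, Function.Surjective fun q : K[X] ↦ aeval B q w := by
  obtain ⟨w, hw⟩ : ∃ w : V, LinearIndependent K ![w, B w] := by
    by_contra! h
    obtain ⟨a, rfl⟩ := B.exists_eq_smul_id_of_forall_notLinearIndependent h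
    exact hDB ((Commute.one_right D).smul_right a)
  have hspan : Submodule.span K (Set.range ![w, B w]) = ⊤ :=
    hw.span_eq_top_of_card_eq_finrank'
      (le_antisymm hw.fintype_card_le_finrank (by simpa using hV))
  refine ⟨w, fun m ↦ ?_⟩
  have hm : m ∈ Submodule.span K {w, B w} := by
    rw [← Matrix.range_cons_cons_empty w (B w) ![], hspan]
    exact Submodule.mem_top
  obtain ⟨a, b, rfl⟩ := Submodule.mem_span_pair.mp hm
  exact ⟨C a + C b * X, by simp⟩

theorem commute_of_commute_of_finrank_le_two {K V : Type*} [Field K] [AddCommGroup V]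
    [Module K V] [FiniteDimensional K V] (hV : Module.finrank K V ≤ 2)
    {A B C D : Module.End K V} (hAB : Commute A B) (hCB : Commute C B) (hDB : ¬ Commute D B) :
    Commute A C := by
  obtain ⟨w, hw⟩ := exists_cyclic_vector_of_finrank_le_two hV hDB
  obtain ⟨q, rfl⟩ := exists_aeval_eq_of_commute hw hAB
  obtain ⟨r, rfl⟩ := exists_aeval_eq_of_commute hw hCB
  exact (Commute.all q r).map (aeval B)

theorem commute_of_commute_of_hasFaithfulRepOfDim_le_two {p d : ℕ} {Γ : Type v} [Group Γ]
    (hΓ : HasFaithfulRepOfDim.{u, v} p Γ d) (hd : d ≤ 2) {a b c g : Γ}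
    (hab : Commute a b) (hcb : Commute c b) (hgb : ¬ Commute g b) : Commute a c := by
  obtain ⟨F, _, _, ρ, hρ⟩ := hΓ
  let σ : Γ →* Module.End F (Fin d → F) :=
    (Matrix.toLinAlgEquiv' (R := F) (n := Fin d) : _ →* _).comp ((Units.coeHom _).comp ρ)
  have hσ : Function.Injective σ :=
    Matrix.toLinAlgEquiv'.injective.comp (Units.val_injective.comp hρ)
  have hdim : Module.finrank F (Fin d → F) ≤ 2 := by simpa using hd
  exact .of_map hσ <| commute_of_commute_of_finrank_le_two hdim (hab.map σ) (hcb.map σ)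
    fun h ↦ hgb (.of_map hσ h)

end CyclicVector

section SemidirectProduct

open SemidirectProduct

theorem commute_inr_inl_iff {N Γ : Type*} [Group N] [Group Γ] {φ : Γ →* MulAut N} {g : Γ} {n : N} :
    Commute (inr g : N ⋊[φ] Γ) (inl n) ↔ φ g n = n := by
  rw [commute_iff_eq, ← mul_inv_eq_iff_eq_mul, ← map_inv, ← inl_aut, inl_inj]

theorem injective_of_injective_comp_inl {N Γ H : Type*} [Group N] [Group Γ] [Group H]
    {φ : Γ →* MulAut N} (hφ : ∀ g n, φ g = MulAut.conj n → g = 1) (ρ : N ⋊[φ] Γ →* H)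
    (hρ : Function.Injective (ρ.comp inl)) : Function.Injective ρ := by
  rw [injective_iff_map_eq_one]
  intro k hk
  have hconj (m : N) : k.left * φ k.right m * k.left⁻¹ = m := by
    apply hρ
    have : (inl (k.left * φ k.right m * k.left⁻¹) : N ⋊[φ] Γ) = k * inl m * k⁻¹ := by
      ext <;> simp
    simp [this, hk]
  have hright : k.right = 1 := hφ _ k.left⁻¹ <| MulEquiv.ext fun m ↦ by
    nth_rw 2 [← hconj m]
    simp [mul_assoc]
  have hleft : k.left = 1 := hρ <| by
    rw [map_one, ← hk, ← inl_left_mul_inr_right k, hright]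
    simp
  exact SemidirectProduct.ext hleft hright

theorem semiconj_zpow {M N : Type*} [Mul M] [Mul N] {f : M → N} {a : MulAut M} {b : MulAut N}
    (h : Function.Semiconj f a b) (n : ℤ) : Function.Semiconj f ⇑(a ^ n) ⇑(b ^ n) := by
  induction n with
  | zero => exact Function.Semiconj.id_right
  | succ n ih =>
    rw [zpow_add_one, zpow_add_one, MulAut.coe_mul, MulAut.coe_mul]
    exact ih.comp_right h
  | pred n ih =>
    have hinv : Function.Semiconj f ⇑a⁻¹ ⇑b⁻¹ :=
      h.inverses_right (MulAut.apply_inv_self _ a) (MulAut.inv_apply_self _ b)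
    rw [zpow_sub_one, zpow_sub_one, MulAut.coe_mul, MulAut.coe_mul]
    exact ih.comp_right hinv

theorem exists_monoidHom_comp_inl_eq {N H : Type*} [Group N] [Group H] {a : MulAut N} (f : N →* H)
    (t : H) (h : f.comp a.toMonoidHom = (MulAut.conj t).toMonoidHom.comp f) :
    ∃ ρ : N ⋊[zpowersHom (MulAut N) a] Multiplicative ℤ →* H, ρ.comp inl = f := by
  refine ⟨lift f (zpowersHom H t) fun n ↦ MonoidHom.ext fun m ↦ ?_, lift_comp_inl ..⟩
  have ha : Function.Semiconj f ⇑a ⇑(MulAut.conj t) := DFunLike.congr_fun h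
  simpa using semiconj_zpow ha n.toAdd m

end SemidirectProduct

namespace FreeByCyclic

open SemidirectProduct

theorem three_le_of_hasFaithfulRepOfDim {p d : ℕ} (h : HasFaithfulRepOfDim.{u, 0} p G d) :
    3 ≤ d := by
  by_contra! hd
  let t : G := inr (Multiplicative.ofAdd 1)
  have commute_t_iff (w : F₂) : Commute (inl w) t ↔ α w = w := by
    rw [Commute.symm_iff, commute_inr_inl_iff]
    simp
  have hx : Commute (inl x) t := by rw [commute_t_iff, α_x]
  have hyxy : Commute (inl (y * x * y⁻¹)) t := by
    rw [commute_t_iff]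
    simp [α_x, α_y]
  have hy : ¬ Commute (inl y) t := by
    rw [commute_t_iff, α_y]
    simp [x, FreeGroup.of_ne_one]
  have hxx : ¬ Commute x (y * x * y⁻¹) := by
    rw [commute_iff_eq]
    decide
  exact hxx <| .of_map inl_injective <|
    commute_of_commute_of_hasFaithfulRepOfDim_le_two h (Nat.le_of_lt_succ hd) hx hyxy hy

/-- The exponent sum of `x`, which every conjugation preserves but no nontrivial power of `α`
does. -/
def xExponentSum : F₂ →* Multiplicative ℤ :=
  FreeGroup.lift ![Multiplicative.ofAdd 1, 1]

theorem α_zpow_x (n : ℤ) : (α ^ n) x = x :=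
  zpow_mem (K := MulAction.stabilizer (MulAut F₂) x) α_x n

theorem α_zpow_y (n : ℤ) : (α ^ n) y = y * x ^ n := by
  induction n with
  | zero => simp
  | succ n ih =>
    rw [zpow_add_one, MulAut.mul_apply, α_y, map_mul, ih, α_zpow_x, mul_assoc, zpow_add_one]
  | pred n ih =>
    have hy : α⁻¹ y = y * x⁻¹ := by
      apply α.injective
      simp [α_x, α_y]
    rw [zpow_sub_one, MulAut.mul_apply, hy, map_mul, map_inv, ih, α_zpow_x, mul_assoc,
      zpow_sub_one]

theorem eq_zero_of_α_zpow_eq_conj {n : ℤ} {w : F₂} (h : α ^ n = MulAut.conj w) : n = 0 := by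
  have hy : y * x ^ n = w * y * w⁻¹ := by rw [← α_zpow_y, h, MulAut.conj_apply]
  simpa [xExponentSum, x, y] using congrArg xExponentSum hy

theorem exists_injective_monoidHom {H : Type*} [Group H] {X Y T : H} (hX : Commute T X)
    (hY : T * Y = Y * X * T) (hfree : Function.Injective (FreeGroup.lift ![X, Y])) :
    ∃ ρ : G →* H, Function.Injective ρ := by
  have hT : (FreeGroup.lift ![X, Y]).comp α.toMonoidHom =
      (MulAut.conj T).toMonoidHom.comp (FreeGroup.lift ![X, Y]) := by
    ext i
    fin_cases i
    · simpa [x, hX.eq] using congrArg (FreeGroup.lift ![X, Y]) α_x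
    · simpa [x, y, hY] using congrArg (FreeGroup.lift ![X, Y]) α_y
  obtain ⟨ρ, hρ⟩ := exists_monoidHom_comp_inl_eq _ T hT
  refine ⟨ρ, injective_of_injective_comp_inl (fun n w h ↦ ?_) ρ (hρ ▸ hfree)⟩
  exact toAdd_eq_zero.mp (eq_zero_of_α_zpow_eq_conj h)

end FreeByCyclic

section PingPong

theorem injective_lift_of_zpow_ping_pong {ι Γ S : Type*} [Nontrivial ι] [Group Γ] [MulAction Γ S]
    (a : ι → Γ) (U : ι → Set S) (hne : ∀ i, (U i).Nonempty)
    (hdisj : Pairwise fun i j ↦ Disjoint (U i) (U j))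
    (hpp : Pairwise fun i j ↦ ∀ n : ℤ, n ≠ 0 → ∀ s ∈ U j, a i ^ n • s ∈ U i) :
    Function.Injective (FreeGroup.lift a) := by
  let f : ι → FreeGroup Unit →* Γ := fun i ↦ FreeGroup.lift fun _ ↦ a i
  have hlift : FreeGroup.lift a =
      (Monoid.CoprodI.lift f).comp (freeGroupEquivCoprodI (ι := ι)).toMonoidHom := by
    ext i
    simp [f]
  rw [hlift, MonoidHom.coe_comp]
  refine .comp (Monoid.CoprodI.lift_injective_of_ping_pong f ?_ U hne hdisj ?_)
    freeGroupEquivCoprodI.injective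
  · obtain ⟨i⟩ : Nonempty ι := inferInstance
    exact Or.inr ⟨i, (Cardinal.natCast_lt_aleph0 (n := 3)).le.trans
      (Cardinal.infinite_iff.mp inferInstance)⟩
  · intro i j hij h hh
    obtain ⟨n, rfl⟩ := FreeGroup.freeGroupUnitEquivInt.symm.surjective h
    have hn : n ≠ 0 := by
      rintro rfl
      exact hh rfl
    rintro _ ⟨s, hs, rfl⟩
    simpa [f, FreeGroup.freeGroupUnitEquivInt] using hpp hij n hn s hs

theorem injective_lift_pair_of_zpow_ping_pong {Γ S : Type*} [Group Γ] [MulAction Γ S] {a b : Γ}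
    {U V : Set S} (hV : V.Nonempty) (hdisj : Disjoint U V)
    (ha : ∀ n : ℤ, n ≠ 0 → ∀ s ∈ V, a ^ n • s ∈ U) (hb : ∀ n : ℤ, n ≠ 0 → ∀ s ∈ U, b ^ n • s ∈ V) :
    Function.Injective (FreeGroup.lift ![a, b]) := by
  have hU : U.Nonempty := ⟨_, ha 1 one_ne_zero _ hV.some_mem⟩
  refine injective_lift_of_zpow_ping_pong _ ![U, V] (Fin.forall_fin_two.mpr ⟨hU, hV⟩) ?_ ?_
  · intro i j hij
    fin_cases i <;> fin_cases j
    exacts [absurd rfl hij, hdisj, hdisj.symm, absurd rfl hij]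
  · intro i j hij
    fin_cases i <;> fin_cases j
    exacts [absurd rfl hij, ha, hb, absurd rfl hij]

open Matrix

section Ring

variable {ι R Γ₀ : Type*} [Ring R] [LinearOrderedCommGroupWithZero Γ₀] {v : Valuation R Γ₀}

theorem val_dotProduct_le [Fintype ι] {w u : ι → R} (hw : ∀ i, v (w i) ≤ 1) {γ : Γ₀}
    (hu : ∀ i, v (u i) ≤ γ) : v (w ⬝ᵥ u) ≤ γ :=
  v.map_sum_le fun i _ ↦ by
    rw [map_mul]
    exact mul_le_of_le_one_of_le (hw i) (hu i)

theorem val_dotProduct_lt [Fintype ι] {w u : ι → R} (hw : ∀ i, v (w i) ≤ 1) {γ : Γ₀} (hγ : γ ≠ 0)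
    (hu : ∀ i, v (u i) < γ) : v (w ⬝ᵥ u) < γ :=
  v.map_sum_lt hγ fun i _ ↦ by
    rw [map_mul]
    exact mul_lt_of_le_one_of_lt (hw i) (hu i)

theorem val_le_of_val_sub_lt {q u : ι → R} {c : R} (hq : ∀ i, v (q i) ≤ 1)
    (hu : ∀ i, v (u i - c * q i) < v c) (i : ι) : v (u i) ≤ v c := by
  have hcq : v (c * q i) ≤ v c := by
    rw [map_mul]
    exact mul_le_of_le_one_right' (hq i)
  simpa using v.map_add_le (hu i).le hcq

end Ring

variable {ι K Γ₀ : Type*} [Field K] [LinearOrderedCommGroupWithZero Γ₀]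
  {v : Valuation K Γ₀}

variable (v) in
/-- The vectors whose direction agrees with that of `q` modulo the maximal ideal of `v`: they are
`c • q` up to an error smaller than the scale `c`. Meaningful when the entries of `q` are integral
and at least one of them is a unit. -/
def nearDirection (q : ι → K) : Set (ι → K) :=
  {u | ∃ c : K, c ≠ 0 ∧ ∀ i, v (u i - c * q i) < v c}

variable (v) in
/-- Up to an integral error, `A` is a large multiple of the rank-one matrix `p wᵀ`, where `p` and
`w` are integral. Then `A` moves every direction on which the functional `w` does not vanish
modulo the maximal ideal of `v` close to the direction of `p`. -/
def Attracts (A : Matrix ι ι K) (p w : ι → K) : Prop :=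
  (∀ i, v (p i) ≤ 1) ∧ (∀ i, v (w i) ≤ 1) ∧
    ∃ z : K, 1 < v z ∧ ∀ i j, v ((A - z • vecMulVec p w) i j) ≤ 1

theorem self_mem_nearDirection (q : ι → K) : q ∈ nearDirection v q :=
  ⟨1, one_ne_zero, fun i ↦ by simp⟩

variable [Fintype ι]

theorem val_dotProduct_sub_lt {w q u : ι → K} {c : K} (hw : ∀ i, v (w i) ≤ 1) (hc : c ≠ 0)
    (hu : ∀ i, v (u i - c * q i) < v c) : v (w ⬝ᵥ u - c * (w ⬝ᵥ q)) < v c := by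
  have := val_dotProduct_lt hw (v.ne_zero_iff.mpr hc) (u := u - c • q) hu
  rwa [dotProduct_sub, dotProduct_smul, smul_eq_mul] at this

theorem val_dotProduct_eq {w q u : ι → K} {c : K} (hw : ∀ i, v (w i) ≤ 1)
    (hwq : v (w ⬝ᵥ q) = 1) (hc : c ≠ 0) (hu : ∀ i, v (u i - c * q i) < v c) :
    v (w ⬝ᵥ u) = v c := by
  have hcq : v (c * (w ⬝ᵥ q)) = v c := by rw [map_mul, hwq, mul_one]
  have := v.map_add_eq_of_lt_left ((val_dotProduct_sub_lt hw hc hu).trans_eq hcq.symm)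
  rwa [add_sub_cancel, hcq] at this

theorem mulVec_mem_nearDirection {A : Matrix ι ι K} (hA : ∀ i j, v (A i j) ≤ 1) {q u : ι → K}
    (hu : u ∈ nearDirection v q) : A *ᵥ u ∈ nearDirection v (A *ᵥ q) := by
  obtain ⟨c, hc, hu⟩ := hu
  exact ⟨c, hc, fun i ↦ val_dotProduct_sub_lt (hA i) hc hu⟩

theorem Attracts.mulVec_mem_nearDirection {A : Matrix ι ι K} {p w q u : ι → K}
    (hA : Attracts v A p w) (hq : ∀ i, v (q i) ≤ 1) (hwq : v (w ⬝ᵥ q) = 1)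
    (hu : u ∈ nearDirection v q) : A *ᵥ u ∈ nearDirection v p := by
  obtain ⟨-, hw, z, hz, hE⟩ := hA
  obtain ⟨c, hc, hu⟩ := hu
  have hwu : v (w ⬝ᵥ u) = v c := val_dotProduct_eq hw hwq hc hu
  have hscale : v c < v (z * (w ⬝ᵥ u)) := by
    rw [map_mul, hwu]
    exact lt_mul_of_one_lt_left (v.pos_iff.mpr hc) hz
  refine ⟨z * (w ⬝ᵥ u), v.pos_iff.mp (zero_le.trans_lt hscale), fun i ↦ ?_⟩
  have herror : (A *ᵥ u) i - z * (w ⬝ᵥ u) * p i = (A - z • vecMulVec p w) i ⬝ᵥ u := by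
    change _ = ((A - z • vecMulVec p w) *ᵥ u) i
    simp only [sub_mulVec, smul_mulVec, vecMulVec_mulVec, Pi.sub_apply, Pi.smul_apply,
      MulOpposite.smul_eq_mul_unop, MulOpposite.unop_op, smul_eq_mul]
    ring
  rw [herror]
  exact (val_dotProduct_le (hE i) (val_le_of_val_sub_lt hq hu)).trans_lt hscale

theorem disjoint_nearDirection {w w' q q' : ι → K} (hw : ∀ i, v (w i) ≤ 1)
    (hw' : ∀ i, v (w' i) ≤ 1) (hq : ∀ i, v (q i) ≤ 1) (hwq : v (w ⬝ᵥ q) = 1)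
    (hwq' : v (w ⬝ᵥ q') < 1) (hw'q' : v (w' ⬝ᵥ q') = 1) :
    Disjoint (nearDirection v q) (nearDirection v q') := by
  rw [Set.disjoint_left]
  rintro u ⟨c, hc, hu⟩ ⟨c', hc', hu'⟩
  have hle : v c' ≤ v c := by
    rw [← val_dotProduct_eq hw' hw'q' hc' hu']
    exact val_dotProduct_le hw' (val_le_of_val_sub_lt hq hu)
  have hlt : v c < v c' := by
    rw [← val_dotProduct_eq hw hwq hc hu, ← sub_add_cancel (w ⬝ᵥ u) (c' * (w ⬝ᵥ q'))]
    refine v.map_add_lt (val_dotProduct_sub_lt hw hc' hu') ?_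
    rw [map_mul]
    exact mul_lt_of_lt_one_right (v.pos_iff.mpr hc') hwq'
  exact hle.not_gt hlt

theorem Attracts.pow_succ_mulVec_mem_nearDirection [DecidableEq ι] {A : Matrix ι ι K}
    {p w q u : ι → K} (hA : Attracts v A p w) (hwp : v (w ⬝ᵥ p) = 1) (hq : ∀ i, v (q i) ≤ 1)
    (hwq : v (w ⬝ᵥ q) = 1) (hu : u ∈ nearDirection v q) (n : ℕ) :
    (A ^ (n + 1)) *ᵥ u ∈ nearDirection v p := by
  induction n with
  | zero => simpa using hA.mulVec_mem_nearDirection hq hwq hu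
  | succ n ih =>
    rw [pow_succ', ← mulVec_mulVec]
    exact hA.mulVec_mem_nearDirection hA.1 hwp ih

theorem exists_units_mul_succ_eq {n : ℤ} (hn : n ≠ 0) :
    ∃ (ε : ℤˣ) (k : ℕ), n = ε * (k + 1 : ℕ) :=
  match n, hn with
  | (k + 1 : ℕ), _ => ⟨1, k, by simp⟩
  | .negSucc k, _ => ⟨-1, k, by simp [Int.negSucc_eq]⟩

theorem injective_lift_of_attracts [DecidableEq ι] {X Y : GL ι K} {p w : ℤˣ → ι → K}
    (hX : ∀ (n : ℤ) i j, v ((X ^ n).val i j) ≤ 1)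
    (hY : ∀ ε : ℤˣ, Attracts v (Y ^ (ε : ℤ)).val (p ε) (w ε))
    (hself : ∀ ε, v (w ε ⬝ᵥ p ε) = 1) (hneg : ∀ ε, v (w (-ε) ⬝ᵥ p ε) < 1)
    (hgen : ∀ n : ℤ, n ≠ 0 → ∀ ε δ, v (w δ ⬝ᵥ (X ^ n).val *ᵥ p ε) = 1) :
    Function.Injective (FreeGroup.lift ![X, Y]) := by
  let near : Set (ι → K) := ⋃ ε, nearDirection v (p ε)
  let far : Set (ι → K) := {u | ∃ n : ℤ, n ≠ 0 ∧ ∃ ε, u ∈ nearDirection v ((X ^ n).val *ᵥ p ε)}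
  have hp ε : ∀ i, v (p ε i) ≤ 1 := (hY ε).1
  have hw ε : ∀ i, v (w ε i) ≤ 1 := (hY ε).2.1
  have hXp (n : ℤ) ε i : v (((X ^ n).val *ᵥ p ε) i) ≤ 1 := val_dotProduct_le (hX n i) (hp ε)
  have hXnear : ∀ n : ℤ, n ≠ 0 → ∀ u ∈ near, X ^ n • u ∈ far := by
    intro n hn u hu
    obtain ⟨ε, hu⟩ := Set.mem_iUnion.mp hu
    exact ⟨n, hn, ε, mulVec_mem_nearDirection (hX n) hu⟩
  have hYfar : ∀ n : ℤ, n ≠ 0 → ∀ u ∈ far, Y ^ n • u ∈ near := by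
    rintro n hn u ⟨m, hm, δ, hu⟩
    obtain ⟨ε, k, rfl⟩ := exists_units_mul_succ_eq hn
    rw [_root_.zpow_mul, zpow_natCast]
    exact Set.mem_iUnion.mpr ⟨ε, (hY ε).pow_succ_mulVec_mem_nearDirection (hself ε) (hXp m δ)
      (hgen m hm δ ε) hu k⟩
  have hdisj : Disjoint far near := by
    rw [Set.disjoint_left]
    rintro u ⟨n, hn, ε, hu⟩ hu'
    obtain ⟨δ, hu'⟩ := Set.mem_iUnion.mp hu'
    exact Set.disjoint_left.mp (disjoint_nearDirection (hw (-δ)) (hw δ) (hXp n ε)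
      (hgen n hn ε (-δ)) (hneg δ) (hself δ)) hu hu'
  have hne : near.Nonempty := ⟨p 1, Set.mem_iUnion.mpr ⟨1, self_mem_nearDirection _⟩⟩
  exact injective_lift_pair_of_zpow_ping_pong hne hdisj hXnear hYfar

end PingPong

section Representation

open Matrix

/-- The diagonal matrix with given invertible entries, as a homomorphism so that relations among
such matrices reduce to relations among their entries. -/
def diagonalGL {ι K : Type*} [Fintype ι] [DecidableEq ι] [CommRing K] : (ι → Kˣ) →* GL ι K :=
  (Units.map (diagonalRingHom ι K : (ι → K) →* Matrix ι ι K)).comp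
    (MulEquiv.piUnits (M := fun _ : ι ↦ K)).symm.toMonoidHom

theorem val_diagonalGL {ι K : Type*} [Fintype ι] [DecidableEq ι] [CommRing K] (d : ι → Kˣ) :
    (diagonalGL d).val = diagonal fun i ↦ (d i : K) :=
  rfl

/-- The image of `y` in the three-dimensional representation: the permutation matrix of
`e₁ ↦ e₂ ↦ e₃ ↦ e₁` plus `z p wᵀ`, where `p = (1, 0, 1)` and `w = (0, 1, -1)`. Its inverse is the
inverse permutation matrix plus `z p' w'ᵀ`, where `p' = (0, 1, 1)` and `w' = (1, 0, -1)`. -/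
def twist {R : Type*} [CommRing R] (z : R) : GL (Fin 3) R where
  val := !![0, z, 1 - z; 1, 0, 0; 0, 1 + z, -z]
  inv := !![0, 1, 0; z, 0, 1 - z; 1 + z, 0, -z]
  val_inv := by
    rw [mul_fin_three, one_fin_three]
    ring_nf
  inv_val := by
    rw [mul_fin_three, one_fin_three]
    ring_nf

/-- `twist z` intertwines `diag (l⁻¹, 1, 1)` and `diag (1, l⁻¹, 1)` because it maps the line `⟨e₁⟩`
to `⟨e₂⟩` and the plane `⟨e₂, e₃⟩` to `⟨e₁, e₃⟩`. -/
theorem diagonalGL_mul_twist {R : Type*} [CommRing R] (l : Rˣ) (z : R) :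
    diagonalGL ![1, l⁻¹, 1] * twist z =
      twist z * diagonalGL ![l⁻¹, l, 1] * diagonalGL ![1, l⁻¹, 1] := by
  rw [mul_assoc, ← map_mul]
  ext i j
  fin_cases i <;> fin_cases j <;> simp [twist, val_diagonalGL, mul_apply, Fin.sum_univ_three]

variable {K Γ₀ : Type*} [Field K] [LinearOrderedCommGroupWithZero Γ₀] {v : Valuation K Γ₀}

theorem attracts_twist {z : K} (hz : 1 < v z) :
    Attracts v (twist z).val ![1, 0, 1] ![0, 1, -1] := by
  simp only [Attracts, Fin.forall_fin_succ]
  refine ⟨by simp, by simp, z, hz, ?_⟩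
  simp [twist]

theorem attracts_twist_inv {z : K} (hz : 1 < v z) :
    Attracts v (twist z)⁻¹.val ![0, 1, 1] ![1, 0, -1] := by
  simp only [Attracts, Fin.forall_fin_succ]
  refine ⟨by simp, by simp, z, hz, ?_⟩
  simp [twist]

theorem val_zpow_le_one {l : Kˣ} (hl : ∀ n : ℤ, n ≠ 0 → v ((l : K) ^ n - 1) = 1) (n : ℤ) :
    v ((l : K) ^ n) ≤ 1 := by
  obtain rfl | hn := eq_or_ne n 0
  · simp
  · simpa using v.map_add_le (hl n hn).le v.map_one.le

theorem injective_lift_diagonalGL_twist {l : Kˣ} {z : K}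
    (hl : ∀ n : ℤ, n ≠ 0 → v ((l : K) ^ n - 1) = 1) (hz : 1 < v z) :
    Function.Injective (FreeGroup.lift ![diagonalGL ![l⁻¹, l, 1], twist z]) := by
  have hX (n : ℤ) : (diagonalGL ![l⁻¹, l, 1] ^ n).val =
      diagonal ![(l : K) ^ (-n), (l : K) ^ n, 1] := by
    rw [← map_zpow, val_diagonalGL]
    congr 1
    ext i
    fin_cases i <;> simp
  have hl' (n : ℤ) (hn : n ≠ 0) : v (((l : K) ^ n)⁻¹ - 1) = 1 := by
    simpa using hl (-n) (neg_ne_zero.mpr hn)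
  refine injective_lift_of_attracts (v := v)
    (p := fun ε ↦ if ε = 1 then ![1, 0, 1] else ![0, 1, 1])
    (w := fun ε ↦ if ε = 1 then ![0, 1, -1] else ![1, 0, -1]) ?_ ?_ ?_ ?_ ?_
  · intro n i j
    rw [hX, diagonal_apply]
    split_ifs
    · fin_cases i
      exacts [val_zpow_le_one hl (-n), val_zpow_le_one hl n, v.map_one.le]
    · simp
  · intro ε
    obtain rfl | rfl := Int.units_eq_one_or ε
    · simpa using attracts_twist hz
    · simpa using attracts_twist_inv hz
  · intro ε
    obtain rfl | rfl := Int.units_eq_one_or ε <;> simp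
  · intro ε
    obtain rfl | rfl := Int.units_eq_one_or ε <;> simp
  · intro n hn ε δ
    rw [hX]
    obtain rfl | rfl := Int.units_eq_one_or ε <;> obtain rfl | rfl := Int.units_eq_one_or δ <;>
      simp [dotProduct, mulVec_diagonal, Fin.sum_univ_three, ← sub_eq_add_neg, hl n hn, hl' n hn]

end Representation

theorem ratFunc_X_zpow_ne_one {k : Type*} [Field k] {n : ℤ} (hn : n ≠ 0) :
    (RatFunc.X : RatFunc k) ^ n ≠ 1 := by
  classical
  intro h
  have := congrArg (RatFunc.inftyValuation k) h
  rw [RatFunc.inftyValuation.X_zpow, map_one, WithZero.exp_eq_one] at this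
  exact hn this

theorem exists_field_charP (p : ℕ) (hp : p = 0 ∨ p.Prime) :
    ∃ (F : Type u) (_ : Field F), CharP F p := by
  obtain rfl | hp := hp
  · exact ⟨ULift ℚ, inferInstance, inferInstance⟩
  · have := Fact.mk hp
    exact ⟨ULift (ZMod p), inferInstance, inferInstance⟩

namespace FreeByCyclic

theorem hasFaithfulRepOfDim_three_of_valuation {K : Type u} [Field K] (p : ℕ) [CharP K p]
    {Γ₀ : Type*} [LinearOrderedCommGroupWithZero Γ₀] {v : Valuation K Γ₀} {l : Kˣ} {z : K}
    (hl : ∀ n : ℤ, n ≠ 0 → v ((l : K) ^ n - 1) = 1) (hz : 1 < v z) :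
    HasFaithfulRepOfDim.{u, 0} p G 3 := by
  have hcomm : Commute (diagonalGL ![1, l⁻¹, 1]) (diagonalGL ![l⁻¹, l, 1]) :=
    (Commute.all _ _).map diagonalGL
  exact ⟨K, _, ‹_›, exists_injective_monoidHom hcomm (diagonalGL_mul_twist l z)
    (injective_lift_diagonalGL_twist hl hz)⟩

theorem hasFaithfulRepOfDim_three (k : Type u) [Field k] (p : ℕ) [CharP k p] :
    HasFaithfulRepOfDim.{u, 0} p G 3 := by
  classical
  have : CharP (RatFunc (RatFunc k)) p :=
    charP_of_injective_ringHom (f := RatFunc.C.comp RatFunc.C) (RingHom.injective _) p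
  refine hasFaithfulRepOfDim_three_of_valuation p (v := RatFunc.inftyValuation (RatFunc k))
    (l := Units.map RatFunc.C.toMonoidHom (Units.mk0 (RatFunc.X : RatFunc k) RatFunc.X_ne_zero))
    (z := RatFunc.X)
    (fun n hn ↦ ?_) ?_
  · have hX : (RatFunc.X : RatFunc k) ^ n - 1 ≠ 0 := sub_ne_zero.mpr (ratFunc_X_zpow_ne_one hn)
    simpa using RatFunc.inftyValuation.C (RatFunc k) hX
  · rw [RatFunc.inftyValuation.X]
    exact WithZero.exp_lt_exp.mpr zero_lt_one

end FreeByCyclic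

theorem mainTheorem12_general (p : ℕ) (hp : p = 0 ∨ p.Prime) :
    minFaithfulDim.{u, 0} p FreeByCyclic.G = 3 := by
  obtain ⟨k, _, _⟩ := exists_field_charP.{u} p hp
  refine le_antisymm (sInf_le ⟨3, rfl, FreeByCyclic.hasFaithfulRepOfDim_three k p⟩) (le_sInf ?_)
  rintro _ ⟨d, rfl, hd⟩
  exact_mod_cast FreeByCyclic.three_le_of_hasFaithfulRepOfDim hd

theorem mainTheorem12 (p : ℕ) (hp : p = 0 ∨ p.Prime) :
    3 ≤ minFaithfulDim.{u, 0} p FreeByCyclic.G ∧ minFaithfulDim.{u, 0} p FreeByCyclic.G ≤ 6 := by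
  rw [mainTheorem12_general p hp]
  norm_num
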